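/- Let $D\subset\mathbb C^n$ be a domain (a nonempty connected open set), let $\{v_a\}_{a\in A}$ be a nonempty family of continuous real-valued functions on $D$ that is uniformly locally bounded, i.e. for every compact $K\subset D$ there is a constant $C_K$ with $|v_a|\le C_K$ on $K$ for all $a\in A$, and let $B\in\mathbb R$. For a locally integrable function $u$ on $D$, write $|\Delta u|\le B$ if the Laplacian of $u$ on $D\subset\mathbb R^{2n}$ in the sense of distributions is a function $g$ with $|g|\le B$ almost everywhere on $D$. Suppose that $|\Delta v_a|\le B$ for all $a\in A$, and that the pointwise infimum $v_{\min}=\inf_{a\in A}v_a$ is plurisubharmonic on $D$. Then $|\Delta v_{\min}|\le B$. -/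

import Mathlib

open MeasureTheory
open scoped ContDiff InnerProductSpace

/-- `g` is the Laplacian of `u` on `D` in the sense of distributions: both are locally integrable
on `D`, and `∫_D u Δφ = ∫_D g φ` for every smooth `φ` with compact support contained in `D`. -/
structure IsWeakLaplacianOn {E : Type*} [NormedAddCommGroup E] [InnerProductSpace ℝ E]
    [FiniteDimensional ℝ E] [MeasurableSpace E] [BorelSpace E]
    (D : Set E) (u g : E → ℝ) : Prop where
  locallyIntegrableOn : LocallyIntegrableOn u D volume
  locallyIntegrableOn_laplacian : LocallyIntegrableOn g D volume
  integral_eq : ∀ φ : E → ℝ, ContDiff ℝ ∞ φ → HasCompactSupport φ → tsupport φ ⊆ D →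
    ∫ x in D, u x * Laplacian.laplacian φ x = ∫ x in D, g x * φ x

/-- `|Δu| ≤ B` on `D`: the distributional Laplacian of `u` on `D` is (given by) a function which is
bounded by `B` almost everywhere on `D`. -/
def AbsLaplacianLEOn {E : Type*} [NormedAddCommGroup E] [InnerProductSpace ℝ E]
    [FiniteDimensional ℝ E] [MeasurableSpace E] [BorelSpace E]
    (D : Set E) (u : E → ℝ) (B : ℝ) : Prop :=
  ∃ g : E → ℝ, IsWeakLaplacianOn D u g ∧ ∀ᵐ x ∂(volume.restrict D), |g x| ≤ B

/-- A real-valued function `u` is plurisubharmonic on `D ⊆ ℂⁿ`: it is upper semicontinuous on `D`,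
and for every closed complex disc `{z + ζ w : |ζ| ≤ 1}` contained in `D` the value of `u` at the
centre is at most its mean over the boundary circle.
(For a real-valued upper semicontinuous function, the mean over the circle being `> -∞` is the same
as integrability over the circle, which is therefore part of the mean value inequality.) -/
structure IsPSHOn {n : ℕ} (D : Set (EuclideanSpace ℂ (Fin n))) (u : EuclideanSpace ℂ (Fin n) → ℝ) :
    Prop where
  upperSemicontinuousOn : UpperSemicontinuousOn u D
  le_circleAverage : ∀ z w : EuclideanSpace ℂ (Fin n),
    (∀ ζ : ℂ, ‖ζ‖ ≤ 1 → z + ζ • w ∈ D) →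
      CircleIntegrable (fun ζ : ℂ => u (z + ζ • w)) 0 1 ∧
        u z ≤ Real.circleAverage (fun ζ : ℂ => u (z + ζ • w)) 0 1

/-- The family `v` is uniformly locally bounded on `D`: on each compact subset of `D`, all members
of the family are bounded by one and the same constant. -/
def UniformlyLocallyBoundedOn {A X : Type*} [TopologicalSpace X] (D : Set X) (v : A → X → ℝ) :
    Prop :=
  ∀ K : Set X, K ⊆ D → IsCompact K → ∃ C : ℝ, ∀ a : A, ∀ x ∈ K, |v a x| ≤ C

open Filter Topology Metric Laplacian
open scoped Convolution

set_option linter.unusedSectionVars false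

/-! ### A radial mollifier and its potential -/

/-! The two bounds `0 ≤ Δ v_min` and `Δ v_min ≤ B` are proved separately in the weak sense, through
solid mean value inequalities; these, unlike the Laplacian, pass to infima. With k = `radialKernel`,
P = `radialPotential`, c = ∫ k and H = ∫ P, the r-derivative of the mollifier r⁻ᵈ k((y - x)/r) is
the Laplacian of the nonnegative test function r¹⁻ᵈ P((y - x)/r), whose integral is r H. Testing `Δv
≤ B` against it and integrating in r shows that the unnormalised mean of v over radius R is at most
c v(x) + B H R²/2 (`radialMean_le_of_isWeakLaplacianOn`). The mean of the infimum is at most the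
mean of each member, so the infimum inherits this bound (`radialMean_iInf_le`). Plurisubharmonicity
gives the opposite inequality with B = 0, by averaging over circles (`IsPSHOn.le_radialMean`). To
return to distributions, the mean is moved onto a test function φ by symmetry, and the expansion of
the mean of φ, namely c φ + (H r²/2) Δφ + o(r²), isolates ∫ u Δφ
(`integral_mul_laplacian_le_of_radialMean_le`). Finally, a functional T on test functions with 0 ≤ T
φ ≤ B ∫ φ for φ ≥ 0 is continuous in a weighted L² norm. The Riesz theorem yields a density, and
Lebesgue differentiation puts it in [0, B] (`exists_locallyIntegrable_of_nonneg_of_le`). -/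

lemma contDiff_deriv_expNegInvGlue : ContDiff ℝ ∞ (deriv expNegInvGlue) :=
  (contDiff_infty_iff_deriv.1 (expNegInvGlue.contDiff (n := ⊤))).2

lemma contDiff_deriv_deriv_expNegInvGlue : ContDiff ℝ ∞ (deriv (deriv expNegInvGlue)) :=
  (contDiff_infty_iff_deriv.1 contDiff_deriv_expNegInvGlue).2

lemma hasDerivAt_deriv_expNegInvGlue (s : ℝ) :
    HasDerivAt (deriv expNegInvGlue) (deriv (deriv expNegInvGlue) s) s :=
  (contDiff_deriv_expNegInvGlue.differentiable (by simp) s).hasDerivAt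

lemma deriv_expNegInvGlue_nonneg (s : ℝ) : 0 ≤ deriv expNegInvGlue s :=
  expNegInvGlue.monotone.deriv_nonneg

/-- At s ≤ 0 the nonnegative function attains its minimum value 0, so Fermat's theorem applies. -/
lemma deriv_expNegInvGlue_of_nonpos {s : ℝ} (hs : s ≤ 0) : deriv expNegInvGlue s = 0 := by
  refine IsLocalMin.deriv_eq_zero (Eventually.of_forall fun t => ?_)
  rw [expNegInvGlue.zero_of_nonpos hs]
  exact expNegInvGlue.nonneg t

lemma deriv_deriv_expNegInvGlue_of_nonpos {s : ℝ} (hs : s ≤ 0) :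
    deriv (deriv expNegInvGlue) s = 0 := by
  refine IsLocalMin.deriv_eq_zero (Eventually.of_forall fun t => ?_)
  rw [deriv_expNegInvGlue_of_nonpos hs]
  exact deriv_expNegInvGlue_nonneg t

section Kernel

variable {E : Type*} [NormedAddCommGroup E] [InnerProductSpace ℝ E]

/-- The radial function `z ↦ 2 f'(1 - |z|²)` supported in the unit ball, where `f` is
`expNegInvGlue`. It satisfies `z • radialKernel z = -∇ radialPotential z`. -/
noncomputable def radialKernel (z : E) : ℝ := 2 * deriv expNegInvGlue (1 - ‖z‖ ^ 2)

/-- The radial bump function `z ↦ f(1 - |z|²)` supported in the unit ball, where `f` is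
`expNegInvGlue`. -/
noncomputable def radialPotential (z : E) : ℝ := expNegInvGlue (1 - ‖z‖ ^ 2)

lemma continuous_radialKernel : Continuous (radialKernel : E → ℝ) :=
  continuous_const.mul (contDiff_deriv_expNegInvGlue.continuous.comp (by fun_prop))

lemma contDiff_radialPotential : ContDiff ℝ ∞ (radialPotential : E → ℝ) :=
  (expNegInvGlue.contDiff (n := ⊤)).comp (contDiff_const.sub (contDiff_norm_sq ℝ))

lemma radialKernel_nonneg (z : E) : 0 ≤ radialKernel z :=
  mul_nonneg zero_le_two (deriv_expNegInvGlue_nonneg _)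

lemma radialPotential_nonneg (z : E) : 0 ≤ radialPotential z := expNegInvGlue.nonneg _

lemma one_sub_normSq_nonpos {z : E} (hz : 1 ≤ ‖z‖) : 1 - ‖z‖ ^ 2 ≤ 0 := by nlinarith

lemma radialKernel_of_one_le {z : E} (hz : 1 ≤ ‖z‖) : radialKernel z = 0 := by
  rw [radialKernel, deriv_expNegInvGlue_of_nonpos (one_sub_normSq_nonpos hz), mul_zero]

lemma radialPotential_of_one_le {z : E} (hz : 1 ≤ ‖z‖) : radialPotential z = 0 :=
  expNegInvGlue.zero_of_nonpos (one_sub_normSq_nonpos hz)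

lemma radialKernel_congr {z w : E} (h : ‖z‖ = ‖w‖) : radialKernel z = radialKernel w := by
  rw [radialKernel, radialKernel, h]

lemma hasCompactSupport_radialKernel [FiniteDimensional ℝ E] :
    HasCompactSupport (radialKernel : E → ℝ) :=
  HasCompactSupport.intro (isCompact_closedBall 0 1) fun z hz =>
    radialKernel_of_one_le (by simpa using (not_le.1 (mt mem_closedBall_zero_iff.2 hz)).le)

lemma hasCompactSupport_radialPotential [FiniteDimensional ℝ E] :
    HasCompactSupport (radialPotential : E → ℝ) :=
  HasCompactSupport.intro (isCompact_closedBall 0 1) fun z hz =>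
    radialPotential_of_one_le (by simpa using (not_le.1 (mt mem_closedBall_zero_iff.2 hz)).le)

lemma hasFDerivAt_comp_one_sub_mul_normSq {f : ℝ → ℝ} {f' : ℝ} (x y : E) (a : ℝ)
    (hf : HasDerivAt f f' (1 - ‖y - x‖ ^ 2 * a)) :
    HasFDerivAt (fun y : E => f (1 - ‖y - x‖ ^ 2 * a))
      ((-(2 * a) * f') • innerSL ℝ (y - x)) y := by
  have h1 : HasFDerivAt (fun y : E => ‖y - x‖ ^ 2) (2 • innerSL ℝ (y - x)) y :=
    ((hasFDerivAt_id y).sub_const x).norm_sq.congr_fderiv (by ext; simp)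
  have h2 := hf.comp_hasFDerivAt y ((h1.mul_const a).const_sub 1)
  refine h2.congr_fderiv ?_
  ext v
  simp
  ring

variable [FiniteDimensional ℝ E]

lemma laplacian_comp_one_sub_mul_normSq {f : ℝ → ℝ} (hf : Differentiable ℝ f)
    (hf' : Differentiable ℝ (deriv f)) (x y : E) (a : ℝ) :
    Δ (fun y : E => f (1 - ‖y - x‖ ^ 2 * a)) y
      = 4 * a ^ 2 * ‖y - x‖ ^ 2 * deriv (deriv f) (1 - ‖y - x‖ ^ 2 * a)
        - 2 * a * Module.finrank ℝ E * deriv f (1 - ‖y - x‖ ^ 2 * a) := by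
  have h1 : fderiv ℝ (fun y : E => f (1 - ‖y - x‖ ^ 2 * a)) =
      fun y => (-(2 * a) * deriv f (1 - ‖y - x‖ ^ 2 * a)) • innerSL ℝ (y - x) := by
    ext1 y
    exact (hasFDerivAt_comp_one_sub_mul_normSq x y a (hf _).hasDerivAt).fderiv
  have h2 : HasFDerivAt
      (fun y => (-(2 * a) * deriv f (1 - ‖y - x‖ ^ 2 * a)) • innerSL ℝ (y - x)) _ y :=
    ((hasFDerivAt_comp_one_sub_mul_normSq x y a (hf' _).hasDerivAt).const_mul (-(2 * a))).smul
      (((innerSL ℝ : E →L[ℝ] E →L[ℝ] ℝ).hasFDerivAt).comp y ((hasFDerivAt_id y).sub_const x))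
  rw [InnerProductSpace.laplacian_eq_iteratedFDeriv_stdOrthonormalBasis]
  simp only [iteratedFDeriv_two_apply, h1, h2.fderiv]
  have h3 := (stdOrthonormalBasis ℝ E).sum_sq_inner_left (y - x)
  have h4 : ∀ i, 4 * a ^ 2 * deriv (deriv f) (1 - ‖y - x‖ ^ 2 * a) *
        inner ℝ (y - x) (stdOrthonormalBasis ℝ E i) ^ 2
      - 2 * a * deriv f (1 - ‖y - x‖ ^ 2 * a) =
      (-(2 * a) * deriv f (1 - ‖y - x‖ ^ 2 * a)) *
        inner ℝ (stdOrthonormalBasis ℝ E i) (stdOrthonormalBasis ℝ E i) +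
      (-(2 * a) * ((-(2 * a) * deriv (deriv f) (1 - ‖y - x‖ ^ 2 * a)) *
        inner ℝ (y - x) (stdOrthonormalBasis ℝ E i))) *
        inner ℝ (y - x) (stdOrthonormalBasis ℝ E i) := by
    intro i
    simp
    ring
  refine (Finset.sum_congr rfl fun i _ => (h4 i).symm).trans ?_
  rw [Finset.sum_sub_distrib, ← Finset.mul_sum, h3]
  simp
  ring

/-- The potential `r ^ (1 - d) • radialPotential ((y - x) / r)`, whose Laplacian is the derivative
with respect to `r` of the mollifier `r ^ (-d) • radialKernel ((y - x) / r)`. -/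
noncomputable def scaledPotential (r : ℝ) (x y : E) : ℝ :=
  r * (r ^ Module.finrank ℝ E)⁻¹ * radialPotential (r⁻¹ • (y - x))

lemma norm_inv_smul_sq (r : ℝ) (z : E) : ‖r⁻¹ • z‖ ^ 2 = ‖z‖ ^ 2 * (r ^ 2)⁻¹ := by
  rw [norm_smul, mul_pow, norm_inv, inv_pow, Real.norm_eq_abs, sq_abs, mul_comm]

lemma contDiff_scaledPotential (r : ℝ) (x : E) : ContDiff ℝ ∞ (scaledPotential r x) :=
  contDiff_const.mul (contDiff_radialPotential.comp (by fun_prop))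

lemma laplacian_scaledPotential (r : ℝ) (x y : E) :
    Δ (scaledPotential r x) y = r * (r ^ Module.finrank ℝ E)⁻¹ *
      (4 * ((r ^ 2)⁻¹) ^ 2 * ‖y - x‖ ^ 2 *
          deriv (deriv expNegInvGlue) (1 - ‖r⁻¹ • (y - x)‖ ^ 2)
        - 2 * (r ^ 2)⁻¹ * Module.finrank ℝ E * deriv expNegInvGlue (1 - ‖r⁻¹ • (y - x)‖ ^ 2)) := by
  have h : scaledPotential r x = (r * (r ^ Module.finrank ℝ E)⁻¹) •
      fun y : E => expNegInvGlue (1 - ‖y - x‖ ^ 2 * (r ^ 2)⁻¹) := by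
    ext y
    simp [scaledPotential, radialPotential, norm_inv_smul_sq]
  rw [h, InnerProductSpace.laplacian_smul, laplacian_comp_one_sub_mul_normSq, smul_eq_mul,
    norm_inv_smul_sq]
  · exact (expNegInvGlue.contDiff (n := ⊤)).differentiable (by simp)
  · exact contDiff_deriv_expNegInvGlue.differentiable (by simp)
  · refine ContDiff.contDiffAt (ContDiff.comp (expNegInvGlue.contDiff (n := 2)) ?_)
    exact contDiff_const.sub (((contDiff_norm_sq ℝ).comp (contDiff_id.sub contDiff_const)).mul
      contDiff_const)

/-- The r-derivative of r⁻ᵈ k(z/r) is -r⁻ᵈ div((z/r) k(z/r)), and w k(w) = -∇P(w) turns this into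
r⁻ᵈ div((∇P)(z/r)) = Δ(r¹⁻ᵈ P(z/r)). The proof compares the explicit formulas. -/
lemma hasDerivAt_scaledKernel {r : ℝ} (hr : r ≠ 0) (x y : E) :
    HasDerivAt (fun r : ℝ => (r ^ Module.finrank ℝ E)⁻¹ * radialKernel (r⁻¹ • (y - x)))
      (Δ (scaledPotential r x) y) r := by
  rw [laplacian_scaledPotential]
  simp only [radialKernel, norm_inv_smul_sq]
  have h1 : HasDerivAt (fun r : ℝ => (r ^ Module.finrank ℝ E)⁻¹)
      (-(Module.finrank ℝ E * (r ^ Module.finrank ℝ E)⁻¹ * r⁻¹)) r := by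
    refine ((hasDerivAt_pow (Module.finrank ℝ E) r).inv (pow_ne_zero _ hr)).congr_deriv ?_
    cases Module.finrank ℝ E with
    | zero => simp
    | succ n => field_simp; simp [pow_succ]
  have h2 : HasDerivAt (fun r : ℝ => 1 - ‖y - x‖ ^ 2 * (r ^ 2)⁻¹)
      (2 * ‖y - x‖ ^ 2 * (r ^ 2)⁻¹ * r⁻¹) r := by
    refine ((((hasDerivAt_pow 2 r).inv (pow_ne_zero _ hr)).const_mul
      (‖y - x‖ ^ 2)).const_sub 1).congr_deriv ?_
    field_simp
    simp
    ring
  refine (h1.mul (((hasDerivAt_deriv_expNegInvGlue _).comp r h2).const_mul 2)).congr_deriv ?_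
  simp only [Function.comp]
  field_simp
  ring

lemma scaledPotential_nonneg {r : ℝ} (hr : 0 ≤ r) (x y : E) : 0 ≤ scaledPotential r x y :=
  mul_nonneg (by positivity) (radialPotential_nonneg _)

lemma one_le_norm_inv_smul {r : ℝ} (hr : 0 < r) {z : E} (hz : r ≤ ‖z‖) : 1 ≤ ‖r⁻¹ • z‖ := by
  rw [norm_smul, norm_inv, Real.norm_of_nonneg hr.le]
  field_simp
  exact hz

lemma scaledPotential_of_le {r : ℝ} (hr : 0 < r) {x y : E} (h : r ≤ ‖y - x‖) :
    scaledPotential r x y = 0 := by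
  rw [scaledPotential, radialPotential_of_one_le (one_le_norm_inv_smul hr h), mul_zero]

lemma laplacian_scaledPotential_of_le {r : ℝ} (hr : 0 < r) {x y : E} (h : r ≤ ‖y - x‖) :
    Δ (scaledPotential r x) y = 0 := by
  have h1 := one_sub_normSq_nonpos (one_le_norm_inv_smul hr h)
  rw [laplacian_scaledPotential, deriv_expNegInvGlue_of_nonpos h1,
    deriv_deriv_expNegInvGlue_of_nonpos h1]
  ring

lemma tsupport_scaledPotential_subset {r : ℝ} (hr : 0 < r) (x : E) :
    tsupport (scaledPotential r x) ⊆ closedBall x r := by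
  refine closure_minimal (fun y hy => ?_) isClosed_closedBall
  rw [mem_closedBall, dist_eq_norm]
  by_contra! h
  exact hy (scaledPotential_of_le hr h.le)

lemma hasCompactSupport_scaledPotential {r : ℝ} (hr : 0 < r) (x : E) :
    HasCompactSupport (scaledPotential r x) :=
  (isCompact_closedBall x r).of_isClosed_subset (isClosed_tsupport _)
    (tsupport_scaledPotential_subset hr x)

/-- Supplies the domination for differentiating means under the integral sign. Inside the support
the argument 1 - |(y - x)/r|² lies in [0, 1], where both derivatives of the profile are bounded; a >
0 controls the negative powers of r. -/
lemma exists_bound_laplacian_scaledPotential {a b : ℝ} (ha : 0 < a) :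
    ∃ C, 0 ≤ C ∧ ∀ r ∈ Set.Icc a b, ∀ x y : E, |Δ (scaledPotential r x) y| ≤ C := by
  obtain ⟨C₁, h₁⟩ := (isCompact_Icc (a := (0 : ℝ)) (b := 1)).exists_bound_of_continuousOn
    contDiff_deriv_expNegInvGlue.continuous.continuousOn
  obtain ⟨C₂, h₂⟩ := (isCompact_Icc (a := (0 : ℝ)) (b := 1)).exists_bound_of_continuousOn
    contDiff_deriv_deriv_expNegInvGlue.continuous.continuousOn
  have hC₁ : 0 ≤ C₁ := (norm_nonneg _).trans (h₁ 0 (by simp))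
  have hC₂ : 0 ≤ C₂ := (norm_nonneg _).trans (h₂ 0 (by simp))
  set d := Module.finrank ℝ E
  refine ⟨a⁻¹ * (a ^ d)⁻¹ * (4 * C₂ + 2 * d * C₁), by positivity, fun r hr x y => ?_⟩
  have hr0 : 0 < r := ha.trans_le hr.1
  rcases le_or_gt r ‖y - x‖ with h | h
  · rw [laplacian_scaledPotential_of_le hr0 h, abs_zero]
    positivity
  set t := ‖r⁻¹ • (y - x)‖ ^ 2 with ht
  have ht' : ‖y - x‖ ^ 2 = t * r ^ 2 := by
    rw [ht, norm_inv_smul_sq]; field_simp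
  have ht0 : 0 ≤ t := by positivity
  have ht1 : t ≤ 1 := by
    have : ‖y - x‖ ^ 2 ≤ r ^ 2 := by gcongr
    rw [ht'] at this
    exact le_of_mul_le_mul_right (by simpa using this) (pow_pos hr0 2)
  have hs : 1 - t ∈ Set.Icc (0 : ℝ) 1 := ⟨by linarith, by linarith⟩
  have e : Δ (scaledPotential r x) y = r⁻¹ * (r ^ d)⁻¹ *
      (4 * t * deriv (deriv expNegInvGlue) (1 - t) - 2 * d * deriv expNegInvGlue (1 - t)) := by
    rw [laplacian_scaledPotential, ht']
    field_simp
    simp [← ht]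
    ring
  rw [e, abs_mul, abs_of_nonneg (a := r⁻¹ * (r ^ d)⁻¹) (by positivity)]
  have hra := hr.1
  have h3 : |4 * t * deriv (deriv expNegInvGlue) (1 - t) - 2 * d * deriv expNegInvGlue (1 - t)|
      ≤ 4 * C₂ + 2 * d * C₁ := by
    refine (abs_sub _ _).trans ?_
    rw [abs_mul (4 * t), abs_mul (2 * (d : ℝ)), abs_of_nonneg (a := 4 * t) (by positivity),
      abs_of_nonneg (a := 2 * (d : ℝ)) (by positivity)]
    have := h₁ _ hs
    have := h₂ _ hs
    simp only [Real.norm_eq_abs] at *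
    gcongr
    nlinarith
  gcongr

variable [MeasurableSpace E] [BorelSpace E]

lemma integral_comp_inv_smul_sub (f : E → ℝ) {r : ℝ} (hr : 0 < r) (x : E) :
    ∫ y, f (r⁻¹ • (y - x)) = r ^ Module.finrank ℝ E * ∫ z, f z := by
  rw [integral_sub_right_eq_self (fun y => f (r⁻¹ • y)) x,
    Measure.integral_comp_inv_smul_of_nonneg _ _ hr.le, smul_eq_mul]

/-- The factor r¹⁻ᵈ against the Jacobian rᵈ leaves r; its integral over [0, R] is the R²/2 of the
mean value inequalities. -/
lemma integral_scaledPotential {r : ℝ} (hr : 0 < r) (x : E) :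
    ∫ y, scaledPotential r x y = r * ∫ z : E, radialPotential z := by
  simp only [scaledPotential]
  rw [integral_const_mul, integral_comp_inv_smul_sub _ hr]
  field_simp

lemma integrable_radialKernel : Integrable (radialKernel : E → ℝ) :=
  continuous_radialKernel.integrable_of_hasCompactSupport hasCompactSupport_radialKernel

lemma integral_radialKernel_nonneg : 0 ≤ ∫ z : E, radialKernel z :=
  integral_nonneg radialKernel_nonneg

lemma integral_radialPotential_pos : 0 < ∫ z : E, radialPotential z :=
  contDiff_radialPotential.continuous.integral_pos_of_hasCompactSupport_nonneg_nonzero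
    hasCompactSupport_radialPotential radialPotential_nonneg (x := 0)
    (by simp [radialPotential])

end Kernel

section Mean

variable {E : Type*} [NormedAddCommGroup E] [InnerProductSpace ℝ E] [FiniteDimensional ℝ E]
  [MeasurableSpace E] [BorelSpace E]

/-! ### Test functions -/

lemma setIntegral_mul_eq_integral_of_tsupport_subset {D : Set E} {φ : E → ℝ} (hφ : tsupport φ ⊆ D)
    (g : E → ℝ) : ∫ x in D, g x * φ x = ∫ x, g x * φ x :=
  setIntegral_eq_integral_of_forall_compl_eq_zero fun x hx => by
    rw [image_eq_zero_of_notMem_tsupport (fun h => hx (hφ h)), mul_zero]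

lemma integrable_mul_of_locallyIntegrableOn {D : Set E} {g φ : E → ℝ}
    (hg : LocallyIntegrableOn g D) (hφ : Continuous φ) (hφc : HasCompactSupport φ)
    (hφD : tsupport φ ⊆ D) : Integrable fun x => g x * φ x := by
  have h1 : IntegrableOn g (tsupport φ) := hg.integrableOn_compact_subset hφD hφc
  have h2 : IntegrableOn (fun x => g x * φ x) (tsupport φ) :=
    h1.mul_continuousOn hφ.continuousOn hφc
  refine (integrableOn_iff_integrable_of_support_subset fun x hx => ?_).1 h2
  exact subset_tsupport φ (right_ne_zero_of_mul hx)

lemma laplacian_eq_zero_of_notMem_tsupport {φ : E → ℝ} {x : E} (hx : x ∉ tsupport φ) :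
    Δ φ x = 0 := by
  rw [InnerProductSpace.laplacian_eq_iteratedFDeriv_stdOrthonormalBasis]
  have h : iteratedFDeriv ℝ 2 φ x = 0 :=
    image_eq_zero_of_notMem_tsupport fun h => hx (tsupport_iteratedFDeriv_subset 2 h)
  simp [h]

lemma tsupport_laplacian_subset (φ : E → ℝ) : tsupport (Δ φ) ⊆ tsupport φ :=
  closure_minimal (fun x hx => by
    by_contra h
    exact hx (laplacian_eq_zero_of_notMem_tsupport h)) (isClosed_tsupport φ)

lemma hasCompactSupport_laplacian {φ : E → ℝ} (hφ : HasCompactSupport φ) :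
    HasCompactSupport (Δ φ) :=
  hφ.of_isClosed_subset (isClosed_tsupport _) (tsupport_laplacian_subset φ)

lemma continuous_laplacian {φ : E → ℝ} (hφ : ContDiff ℝ ∞ φ) : Continuous (Δ φ) := by
  rw [InnerProductSpace.laplacian_eq_iteratedFDeriv_stdOrthonormalBasis]
  have h : Continuous (iteratedFDeriv ℝ 2 φ) := 
    (contDiff_infty.1 hφ 2).continuous_iteratedFDeriv'
  fun_prop

lemma isWeakLaplacianOn_laplacian {φ : E → ℝ} (hφ : ContDiff ℝ ∞ φ) (hφc : HasCompactSupport φ)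
    (D : Set E) : IsWeakLaplacianOn D φ (Δ φ) where
  locallyIntegrableOn := hφ.continuous.locallyIntegrable.locallyIntegrableOn D
  locallyIntegrableOn_laplacian := (continuous_laplacian hφ).locallyIntegrable.locallyIntegrableOn D
  integral_eq ψ hψ hψc hψD := by
    rw [setIntegral_mul_eq_integral_of_tsupport_subset hψD,
      setIntegral_mul_eq_integral_of_tsupport_subset ((tsupport_laplacian_subset ψ).trans hψD)]
    have := SchwartzMap.integral_mul_laplacian_right_eq_left (μ := volume)
      (hφc.toSchwartzMap hφ) (hψc.toSchwartzMap hψ)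
    simp only [SchwartzMap.laplacian_apply] at this
    exact this

/-! ### Mean value inequalities -/

/-- The mean of `u` with respect to the mollifier on the ball of centre `x` and radius `r`, not
normalised by the mass of the mollifier. -/
noncomputable def radialMean (u : E → ℝ) (r : ℝ) (x : E) : ℝ :=
  ∫ z, u (x + r • z) * radialKernel z

/-- Moves the dependence on r from u to the smooth kernel, so that the mean can be differentiated in
r for u merely integrable. The cutoff to the ball of radius R does not depend on r. -/
lemma radialMean_eq_integral {u : E → ℝ} {r R : ℝ} (hr : 0 < r) (hrR : r ≤ R) (x : E) :
    radialMean u r x = ∫ y, (closedBall x R).indicator u y *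
      ((r ^ Module.finrank ℝ E)⁻¹ * radialKernel (r⁻¹ • (y - x))) := by
  have h := integral_comp_inv_smul_sub (fun z : E => u (x + r • z) * radialKernel z) hr x
  have h2 : radialMean u r x = (r ^ Module.finrank ℝ E)⁻¹ *
      ∫ y, u (x + r • r⁻¹ • (y - x)) * radialKernel (r⁻¹ • (y - x)) := by
    rw [h, radialMean]; field_simp
  rw [h2, ← integral_const_mul]
  congr 1 with y
  rw [smul_inv_smul₀ hr.ne', add_sub_cancel]
  by_cases hy : y ∈ closedBall x R
  · rw [Set.indicator_of_mem hy]; ring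
  · rw [mem_closedBall, dist_eq_norm, not_le] at hy
    rw [radialKernel_of_one_le (one_le_norm_inv_smul hr (hrR.trans hy.le))]
    ring

lemma hasDerivAt_radialMean {u : E → ℝ} {r R : ℝ} (hr : 0 < r) (hrR : r < R) (x : E)
    (hu : IntegrableOn u (closedBall x R)) :
    HasDerivAt (fun r => radialMean u r x)
      (∫ y, (closedBall x R).indicator u y * Δ (scaledPotential r x) y) r := by
  have hi : Integrable ((closedBall x R).indicator u) :=
    hu.integrable_indicator measurableSet_closedBall
  obtain ⟨C, hC, hCb⟩ := exists_bound_laplacian_scaledPotential (E := E) (a := r / 2) (b := R)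
    (by positivity)
  have hs : Set.Icc (r / 2) R ∈ 𝓝 r := Icc_mem_nhds (by linarith) hrR
  have hk : ∀ s : ℝ, Continuous fun y : E =>
      (s ^ Module.finrank ℝ E)⁻¹ * radialKernel (s⁻¹ • (y - x)) := fun s =>
    continuous_const.mul (continuous_radialKernel.comp (by fun_prop))
  have hkc : HasCompactSupport fun y : E =>
      (r ^ Module.finrank ℝ E)⁻¹ * radialKernel (r⁻¹ • (y - x)) :=
    HasCompactSupport.intro (isCompact_closedBall x r) fun y hy => by
      rw [mem_closedBall, dist_eq_norm, not_le] at hy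
      rw [radialKernel_of_one_le (one_le_norm_inv_smul hr hy.le), mul_zero]
  have key := hasDerivAt_integral_of_dominated_loc_of_deriv_le (μ := (volume : Measure E))
    (F := fun s y => (closedBall x R).indicator u y *
      ((s ^ Module.finrank ℝ E)⁻¹ * radialKernel (s⁻¹ • (y - x))))
    (F' := fun s y => (closedBall x R).indicator u y * Δ (scaledPotential s x) y)
    (bound := fun y => |(closedBall x R).indicator u y| * C) hs
    (Eventually.of_forall fun s => hi.aestronglyMeasurable.mul (hk s).aestronglyMeasurable)
    (integrable_mul_of_locallyIntegrableOn (D := Set.univ) (hi.locallyIntegrable.locallyIntegrableOn _)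
      (hk r) hkc (Set.subset_univ _))
    (hi.aestronglyMeasurable.mul
      (continuous_laplacian (contDiff_scaledPotential r x)).aestronglyMeasurable)
    (Eventually.of_forall fun y s hs => by
      rw [norm_mul, Real.norm_eq_abs, Real.norm_eq_abs]
      exact mul_le_mul_of_nonneg_left (hCb s hs x y) (abs_nonneg _))
    (hi.abs.mul_const C)
    (Eventually.of_forall fun y s hs =>
      (hasDerivAt_scaledKernel ((half_pos hr).trans_le hs.1).ne' x y).const_mul _)
  refine key.2.congr_of_eventuallyEq ?_
  filter_upwards [hs] with s hs
  exact radialMean_eq_integral ((half_pos hr).trans_le hs.1) hs.2 x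

/-- The endpoint r = 0, where the mean is c u(x), is the point of this lemma: the derivative formula
is available only for r > 0. -/
lemma continuousOn_radialMean {u : E → ℝ} {R : ℝ} (x : E) (hu : ContinuousOn u (closedBall x R)) :
    ContinuousOn (fun r => radialMean u r x) (Set.Icc 0 R) := by
  obtain ⟨C, hC⟩ := (isCompact_closedBall x R).exists_bound_of_continuousOn hu
  have hmem : ∀ r ∈ Set.Icc 0 R, ∀ z : E, ‖z‖ ≤ 1 → x + r • z ∈ closedBall x R := by
    intro r hr z hz
    rw [mem_closedBall, dist_eq_norm, add_sub_cancel_left, norm_smul, Real.norm_of_nonneg hr.1]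
    nlinarith [hr.1, hr.2, norm_nonneg z]
  refine continuousOn_of_dominated (bound := fun z => C * radialKernel z) ?_ ?_
    (integrable_radialKernel.const_mul C) ?_
  · intro r hr
    have h1 : ContinuousOn (fun z => u (x + r • z) * radialKernel z) (closedBall 0 1) :=
      (hu.comp (by fun_prop) fun z hz => hmem r hr z (by simpa using hz)).mul
        continuous_radialKernel.continuousOn
    have h2 : (fun z => u (x + r • z) * radialKernel z) =
        (closedBall 0 1).indicator fun z => u (x + r • z) * radialKernel z := by
      refine (Set.indicator_eq_self.2 fun z hz => ?_).symm
      by_contra hz'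
      rw [mem_closedBall_zero_iff, not_le] at hz'
      exact hz (by simp [radialKernel_of_one_le hz'.le])
    rw [h2]
    exact (aestronglyMeasurable_indicator_iff measurableSet_closedBall).2
      (h1.aestronglyMeasurable measurableSet_closedBall)
  · refine fun r hr => Eventually.of_forall fun z => ?_
    rw [norm_mul, Real.norm_of_nonneg (radialKernel_nonneg z)]
    rcases le_or_gt ‖z‖ 1 with hz | hz
    · exact mul_le_mul_of_nonneg_right (hC _ (hmem r hr z hz)) (radialKernel_nonneg z)
    · simp [radialKernel_of_one_le hz.le]
  · refine Eventually.of_forall fun z => ?_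
    rcases le_or_gt ‖z‖ 1 with hz | hz
    · exact (hu.comp (by fun_prop) fun r hr => hmem r hr z hz).mul continuousOn_const
    · simpa [radialKernel_of_one_le hz.le] using continuousOn_const

/-- A continuous function whose weak Laplacian is at most `B` satisfies the corresponding mean value
inequality on every closed ball in its domain. -/
theorem radialMean_le_of_isWeakLaplacianOn {D : Set E} {v g : E → ℝ} {B : ℝ}
    (hv : ContinuousOn v D) (hg : IsWeakLaplacianOn D v g)
    (hB : ∀ᵐ x ∂(volume.restrict D), g x ≤ B) {x : E} {R : ℝ} (hR : 0 ≤ R)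
    (hRD : closedBall x R ⊆ D) :
    radialMean v R x ≤
      (∫ z : E, radialKernel z) * v x + B * (R ^ 2 / 2 * ∫ z : E, radialPotential z) := by
  set H := ∫ z : E, radialPotential z
  -- The comparison term has derivative B r H, which is B times the integral of the potential, so
  -- the difference has derivative ≤ 0.
  have hanti : AntitoneOn (fun r => radialMean v r x - B * (r ^ 2 / 2 * H)) (Set.Icc 0 R) := by
    have hderiv : ∀ r ∈ Set.Ioo 0 R, HasDerivAt (fun r => radialMean v r x - B * (r ^ 2 / 2 * H))
        ((∫ y, (closedBall x R).indicator v y * Δ (scaledPotential r x) y) - B * (r * H)) r := by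
      intro r hr
      refine (hasDerivAt_radialMean hr.1 hr.2 x
        ((hv.mono hRD).integrableOn_compact (isCompact_closedBall x R))).sub ?_
      refine ((((hasDerivAt_pow 2 r).div_const 2).mul_const H).const_mul B).congr_deriv ?_
      simp
    refine antitoneOn_of_deriv_nonpos (convex_Icc 0 R)
      ((continuousOn_radialMean x (hv.mono hRD)).sub (by fun_prop)) ?_ ?_
    · rw [interior_Icc]
      exact fun r hr => (hderiv r hr).differentiableAt.differentiableWithinAt
    · rw [interior_Icc]
      intro r hr
      rw [(hderiv r hr).deriv, sub_nonpos]
      have hsub := tsupport_scaledPotential_subset hr.1 x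
      have hsub' : tsupport (scaledPotential r x) ⊆ D :=
        (hsub.trans (closedBall_subset_closedBall hr.2.le)).trans hRD
      have e1 : ∫ y, (closedBall x R).indicator v y * Δ (scaledPotential r x) y =
          ∫ y in D, v y * Δ (scaledPotential r x) y := by
        rw [setIntegral_mul_eq_integral_of_tsupport_subset
          ((tsupport_laplacian_subset _).trans hsub')]
        congr 1 with y
        by_cases hy : y ∈ closedBall x R
        · rw [Set.indicator_of_mem hy]
        · rw [mem_closedBall, dist_eq_norm, not_le] at hy
          rw [laplacian_scaledPotential_of_le hr.1 (hr.2.trans hy).le, mul_zero, mul_zero]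
      have hψ := contDiff_scaledPotential r x
      have hψc := hasCompactSupport_scaledPotential hr.1 x
      rw [e1, hg.integral_eq _ hψ hψc hsub', ← integral_scaledPotential hr.1 x,
        ← integral_const_mul, ← setIntegral_mul_eq_integral_of_tsupport_subset hsub']
      refine integral_mono_ae
        (integrable_mul_of_locallyIntegrableOn hg.locallyIntegrableOn_laplacian hψ.continuous hψc
          hsub').integrableOn
        ((hψ.continuous.integrable_of_hasCompactSupport hψc).const_mul B).integrableOn ?_
      filter_upwards [hB] with y hy
      exact mul_le_mul_of_nonneg_right hy (scaledPotential_nonneg hr.1.le x y)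
  have h := hanti (Set.left_mem_Icc.2 hR) (Set.right_mem_Icc.2 hR) hR
  have h0 : radialMean v 0 x = (∫ z : E, radialKernel z) * v x := by
    simp only [radialMean, zero_smul, add_zero]
    rw [integral_const_mul, mul_comm]
  simp only [h0] at h
  linarith

lemma radialMean_neg (u : E → ℝ) (r : ℝ) (x : E) :
    radialMean (fun y => -u y) r x = -radialMean u r x := by
  simp only [radialMean, neg_mul, integral_neg]

/-- The second order expansion of the radial means of a test function, uniformly in the centre. -/
theorem exists_abs_radialMean_sub_le {φ : E → ℝ} (hφ : ContDiff ℝ ∞ φ) (hφc : HasCompactSupport φ)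
    {ε : ℝ} (hε : 0 < ε) :
    ∃ δ > 0, ∀ r, 0 ≤ r → r < δ → ∀ x,
      |radialMean φ r x - (∫ z : E, radialKernel z) * φ x
        - Δ φ x * (r ^ 2 / 2 * ∫ z : E, radialPotential z)|
        ≤ ε * (r ^ 2 / 2 * ∫ z : E, radialPotential z) := by
  have huc : UniformContinuous (Δ φ) :=
    
    (hasCompactSupport_laplacian hφc).uniformContinuous_of_continuous (continuous_laplacian hφ)
  obtain ⟨δ, hδ, h⟩ := Metric.uniformContinuous_iff.1 huc ε hε
  refine ⟨δ, hδ, fun r hr hrδ x => ?_⟩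
  have hsub : closedBall x r ⊆ ball x δ := closedBall_subset_ball hrδ
  have hclose : ∀ y ∈ ball x δ, |Δ φ y - Δ φ x| < ε := fun y hy => h hy
  -- On the ball of radius δ, uniform continuity gives Δφ ≤ Δφ(x) + ε, so the mean value inequality
  -- is used there with that constant; applying it to -φ gives the lower bound.
  have h1 := radialMean_le_of_isWeakLaplacianOn hφ.continuous.continuousOn
    (isWeakLaplacianOn_laplacian hφ hφc (ball x δ)) (B := Δ φ x + ε)
    ((ae_restrict_iff' measurableSet_ball).2 (Eventually.of_forall fun y hy => by
      linarith [(abs_lt.1 (hclose y hy)).2])) hr hsub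
  have hneg : Δ (fun y => -φ y) = fun y => -Δ φ y := InnerProductSpace.laplacian_neg
  have h2 := radialMean_le_of_isWeakLaplacianOn hφ.neg.continuous.continuousOn
    (isWeakLaplacianOn_laplacian hφ.neg hφc.neg (ball x δ)) (B := -Δ φ x + ε)
    ((ae_restrict_iff' measurableSet_ball).2 (Eventually.of_forall fun y hy => by
      have := congrFun hneg y
      simp only [this]
      linarith [(abs_lt.1 (hclose y hy)).1])) hr hsub
  rw [radialMean_neg] at h2
  rw [abs_le]
  constructor <;> linarith

end Mean

/-! ### From mean value inequalities to distributional inequalities -/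

section Duality

variable {E : Type*} [NormedAddCommGroup E] [InnerProductSpace ℝ E] [FiniteDimensional ℝ E]
  [MeasurableSpace E] [BorelSpace E]

/-- `u` is Borel measurable on `D` and bounded on every compact subset of `D`. -/
structure MeasurableLocallyBoundedOn (D : Set E) (u : E → ℝ) : Prop where
  measurable_indicator : Measurable (D.indicator u)
  exists_bound : ∀ K ⊆ D, IsCompact K → ∃ C, ∀ x ∈ K, |u x| ≤ C

lemma MeasurableLocallyBoundedOn.neg {D : Set E} {u : E → ℝ} (hu : MeasurableLocallyBoundedOn D u) :
    MeasurableLocallyBoundedOn D (fun x => -u x) where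
  measurable_indicator := by
    have := hu.measurable_indicator.neg
    rwa [← Set.indicator_neg'] at this
  exists_bound K hK hKc := by simpa using hu.exists_bound K hK hKc

lemma MeasurableLocallyBoundedOn.exists_measurable_bounded {D : Set E} {u : E → ℝ}
    (hu : MeasurableLocallyBoundedOn D u) {K : Set E} (hK : K ⊆ D) (hKc : IsCompact K) :
    Measurable (K.indicator u) ∧ ∃ C, ∀ x, |K.indicator u x| ≤ C := by
  constructor
  · have h : K.indicator u = K.indicator (D.indicator u) := by
      rw [Set.indicator_indicator, Set.inter_eq_left.2 hK]
    rw [h]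
    exact hu.measurable_indicator.indicator hKc.isClosed.measurableSet
  · obtain ⟨C, hC⟩ := hu.exists_bound K hK hKc
    refine ⟨max C 0, fun x => ?_⟩
    by_cases hx : x ∈ K
    · rw [Set.indicator_of_mem hx]
      exact (hC x hx).trans (le_max_left _ _)
    · rw [Set.indicator_of_notMem hx, abs_zero]
      exact le_max_right _ _

lemma MeasurableLocallyBoundedOn.integrable_indicator {D : Set E} {u : E → ℝ}
    (hu : MeasurableLocallyBoundedOn D u) {K : Set E} (hK : K ⊆ D) (hKc : IsCompact K) :
    Integrable (K.indicator u) := by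
  obtain ⟨hm, C, hC⟩ := hu.exists_measurable_bounded hK hKc
  have h1 : IntegrableOn (K.indicator u) K :=
    Measure.integrableOn_of_bounded (M := C) hKc.measure_lt_top.ne hm.aestronglyMeasurable
      (Eventually.of_forall hC)
  exact (integrableOn_iff_integrable_of_support_subset Set.support_indicator_subset).1 h1

lemma MeasurableLocallyBoundedOn.locallyIntegrableOn {D : Set E} (hD : IsOpen D) {u : E → ℝ}
    (hu : MeasurableLocallyBoundedOn D u) : LocallyIntegrableOn u D := by
  rw [locallyIntegrableOn_iff hD.isLocallyClosed]
  intro K hK hKc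
  exact (integrable_indicator_iff hKc.isClosed.measurableSet).1 (hu.integrable_indicator hK hKc)

lemma integrable_comp_mul_radialKernel {w : E → ℝ} (hw : Measurable w) {C : ℝ}
    (hC : ∀ x, |w x| ≤ C) (x : E) (r : ℝ) :
    Integrable fun z => w (x + r • z) * radialKernel z :=
  integrable_radialKernel.bdd_mul (c := C)
    (hw.comp (by fun_prop : Measurable fun z : E => x + r • z)).aestronglyMeasurable
    (Eventually.of_forall fun _ => hC _)

lemma add_smul_mem_closedBall {r : ℝ} (hr : 0 ≤ r) (x : E) {z : E} (hz : ‖z‖ ≤ 1) :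
    x + r • z ∈ closedBall x r := by
  rw [mem_closedBall, dist_eq_norm, add_sub_cancel_left, norm_smul, Real.norm_of_nonneg hr]
  nlinarith

lemma mul_radialKernel_congr {u w : E → ℝ} {x : E} {r : ℝ} (hr : 0 ≤ r)
    (h : Set.EqOn u w (closedBall x r)) (z : E) :
    u (x + r • z) * radialKernel z = w (x + r • z) * radialKernel z := by
  rcases le_or_gt ‖z‖ 1 with hz | hz
  · rw [h (add_smul_mem_closedBall hr x hz)]
  · simp [radialKernel_of_one_le hz.le]

lemma radialMean_congr {u w : E → ℝ} {x : E} {r : ℝ} (hr : 0 ≤ r)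
    (h : Set.EqOn u w (closedBall x r)) : radialMean u r x = radialMean w r x := by
  rw [radialMean, radialMean]
  congr 1 with z
  exact mul_radialKernel_congr hr h z

lemma MeasurableLocallyBoundedOn.integrable_comp_mul_radialKernel {D : Set E} {u : E → ℝ}
    (hu : MeasurableLocallyBoundedOn D u) {x : E} {r : ℝ} (hr : 0 ≤ r) (hD : closedBall x r ⊆ D) :
    Integrable fun z => u (x + r • z) * radialKernel z := by
  obtain ⟨hm, C, hC⟩ := hu.exists_measurable_bounded hD (isCompact_closedBall x r)
  refine (_root_.integrable_comp_mul_radialKernel hm hC x r).congr (Eventually.of_forall fun z => ?_)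
  exact mul_radialKernel_congr hr (fun y hy => Set.indicator_of_mem hy u) z

lemma integrable_prod_radialKernel {w φ : E → ℝ} (hw : Measurable w) {C : ℝ} (hC : ∀ x, |w x| ≤ C)
    (hφ : Integrable φ) (r : ℝ) :
    Integrable (fun p : E × E => φ p.1 * (w (p.1 + r • p.2) * radialKernel p.2))
      (volume.prod volume) := by
  have h1 : Integrable (fun p : E × E => φ p.1 * radialKernel p.2) (volume.prod volume) :=
    hφ.mul_prod integrable_radialKernel
  refine (h1.bdd_mul (c := C) (f := fun p : E × E => w (p.1 + r • p.2))
    (hw.comp (by fun_prop)).aestronglyMeasurable (Eventually.of_forall fun _ => hC _)).congr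
    (Eventually.of_forall fun p => ?_)
  simp only
  ring

/-- The radial means are symmetric. -/
lemma integral_mul_radialMean_comm {w φ : E → ℝ} (hw : Measurable w) {C : ℝ} (hC : ∀ x, |w x| ≤ C)
    (hwi : Integrable w) (hφ : Measurable φ) {C' : ℝ} (hC' : ∀ x, |φ x| ≤ C')
    (hφi : Integrable φ) (r : ℝ) :
    ∫ x, φ x * radialMean w r x = ∫ x, w x * radialMean φ r x := by
  simp only [radialMean, ← integral_const_mul]
  refine (integral_integral_swap (integrable_prod_radialKernel hw hC hφi r)).trans
    (Eq.trans ?_ (integral_integral_swap (integrable_prod_radialKernel hφ hC' hwi r)).symm)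
  -- Reflecting z, which the even kernel permits, and translating x by r z exchanges the roles of
  -- the two functions.
  rw [← integral_neg_eq_self]
  congr 1 with z
  rw [← integral_add_right_eq_self _ (r • z)]
  congr 1 with x
  rw [radialKernel_congr (norm_neg z)]
  simp
  ring

/-- If a locally bounded function satisfies the mean value inequality for the bound `B` on all closed
balls in `D`, then its distributional Laplacian is at most `B`. -/
theorem integral_mul_laplacian_le_of_radialMean_le {D : Set E} (hD : IsOpen D) {u : E → ℝ}
    (hu : MeasurableLocallyBoundedOn D u) {B : ℝ}
    (hmean : ∀ (x : E) (R : ℝ), 0 ≤ R → closedBall x R ⊆ D → radialMean u R x ≤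
      (∫ z : E, radialKernel z) * u x + B * (R ^ 2 / 2 * ∫ z : E, radialPotential z))
    {φ : E → ℝ} (hφ : ContDiff ℝ ∞ φ) (hφc : HasCompactSupport φ) (hφD : tsupport φ ⊆ D)
    (hφ0 : ∀ x, 0 ≤ φ x) :
    ∫ x in D, u x * Δ φ x ≤ B * ∫ x, φ x := by
  obtain ⟨δ, hδ, hδD⟩ := hφc.isCompact.exists_cthickening_subset_open hD hφD
  set K := cthickening δ (tsupport φ) with hK
  have hKc : IsCompact K := hφc.isCompact.cthickening
  have hKsub : tsupport φ ⊆ K := self_subset_cthickening _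
  obtain ⟨hwm, C, hC⟩ := hu.exists_measurable_bounded hδD hKc
  have hwi := hu.integrable_indicator hδD hKc
  set w := K.indicator u with hw
  have hwu : ∀ x ∈ K, w x = u x := fun x hx => Set.indicator_of_mem hx u
  set H := ∫ z : E, radialPotential z with hH
  set c := ∫ z : E, radialKernel z with hc
  have hHpos : 0 < H := integral_radialPotential_pos
  have hφi : Integrable φ := hφ.continuous.integrable_of_hasCompactSupport hφc
  obtain ⟨C', hC'⟩ := hφc.exists_bound_of_continuous hφ.continuous
  have hLi : Integrable (Δ φ) :=
    (continuous_laplacian hφ).integrable_of_hasCompactSupport (hasCompactSupport_laplacian hφc)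
  have hwφ : Integrable fun x => w x * φ x :=
    hφi.bdd_mul hwm.aestronglyMeasurable (Eventually.of_forall hC)
  have hwL : Integrable fun x => w x * Δ φ x :=
    hLi.bdd_mul hwm.aestronglyMeasurable (Eventually.of_forall hC)
  have e0 : ∫ x in D, u x * Δ φ x = ∫ x, w x * Δ φ x := by
    rw [setIntegral_mul_eq_integral_of_tsupport_subset ((tsupport_laplacian_subset φ).trans hφD)]
    congr 1 with x
    by_cases hx : x ∈ K
    · rw [hwu x hx]
    · rw [laplacian_eq_zero_of_notMem_tsupport fun h => hx (hKsub h), mul_zero, mul_zero]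
  rw [e0]
  refine le_of_forall_pos_le_add fun η hη => ?_
  have hW : 0 ≤ ∫ x, |w x| := integral_nonneg fun x => abs_nonneg _
  -- The final error is ε ∫ |w|; the + 1 in the denominator covers ∫ |w| = 0.
  obtain ⟨ε, hε, hεη⟩ : ∃ ε > 0, ε * ∫ x, |w x| ≤ η := by
    refine ⟨η / ((∫ x, |w x|) + 1), by positivity, ?_⟩
    rw [div_mul_eq_mul_div, div_le_iff₀ (by positivity)]
    nlinarith
  obtain ⟨δ', hδ', hexp⟩ := exists_abs_radialMean_sub_le hφ hφc hε
  -- r ≤ δ keeps balls centred on the support of φ inside K, and r < δ' makes the second order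
  -- expansion valid.
  obtain ⟨r, hr, hrδ, hrδ'⟩ : ∃ r, 0 < r ∧ r ≤ δ ∧ r < δ' :=
    ⟨min δ (δ' / 2), by positivity, min_le_left _ _, (min_le_right _ _).trans_lt (by linarith)⟩
  set q := r ^ 2 / 2 * H with hq
  have hqpos : 0 < q := by positivity
  have hi1 : Integrable fun x => φ x * radialMean w r x := by
    simp only [radialMean, ← integral_const_mul]
    exact (integrable_prod_radialKernel hwm hC hφi r).integral_prod_left
  have hi2 : Integrable fun x => w x * radialMean φ r x := by
    simp only [radialMean, ← integral_const_mul]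
    exact (integrable_prod_radialKernel hφ.continuous.measurable hC' hwi r).integral_prod_left
  -- The integral of φ times the mean of w is bounded above by the mean value hypothesis, and below,
  -- after symmetry, by the expansion of the mean of φ. The c-terms cancel, and dividing by q > 0
  -- leaves the claim up to η.
  have h1 : ∫ x, φ x * radialMean w r x ≤ ∫ x, (c * (w x * φ x) + B * q * φ x) := by
    refine integral_mono hi1 ((hwφ.const_mul c).add (hφi.const_mul _)) fun x => ?_
    by_cases hx : x ∈ tsupport φ
    · have hball : closedBall x r ⊆ K :=
        (closedBall_subset_closedBall hrδ).trans (closedBall_subset_cthickening hx δ)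
      have h := hmean x r hr.le (hball.trans hδD)
      rw [radialMean_congr hr.le fun y hy => (hwu y (hball hy)).symm, ← hwu x (hKsub hx)] at h
      have := mul_le_mul_of_nonneg_left h (hφ0 x)
      rw [← hq] at this
      simp only
      linarith
    · simp [image_eq_zero_of_notMem_tsupport hx]
  have h2 : ∫ x, (w x * Δ φ x * q - |w x| * (ε * q)) ≤
      ∫ x, (w x * radialMean φ r x - c * (w x * φ x)) := by
    refine integral_mono ((hwL.mul_const q).sub (hwi.abs.mul_const _))
      (hi2.sub (hwφ.const_mul c)) fun x => ?_
    have h := hexp r hr.le hrδ' x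
    have h3 : |w x * (radialMean φ r x - c * φ x - Δ φ x * q)| ≤ |w x| * (ε * q) := by
      rw [abs_mul]
      exact mul_le_mul_of_nonneg_left h (abs_nonneg _)
    have := (abs_le.1 h3).1
    simp only
    linarith
  rw [integral_sub (hwL.mul_const q) (hwi.abs.mul_const _), integral_sub hi2 (hwφ.const_mul c),
    integral_mul_const, integral_mul_const, integral_const_mul,
    ← integral_mul_radialMean_comm hwm hC hwi hφ.continuous.measurable hC' hφi] at h2
  rw [integral_add (hwφ.const_mul c) (hφi.const_mul _), integral_const_mul, integral_const_mul] at h1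
  have h4 : q * ∫ x, w x * Δ φ x ≤ q * (B * (∫ x, φ x) + ε * ∫ x, |w x|) := by linarith
  have := le_of_mul_le_mul_left h4 hqpos
  linarith

/-- The infimum of a family of continuous functions with weak Laplacian at most `B` satisfies the
mean value inequality for the bound `B`. -/
theorem radialMean_iInf_le {D : Set E} {A : Type*} [Nonempty A] {v : A → E → ℝ}
    (hcont : ∀ a, ContinuousOn (v a) D)
    (hbdd : ∀ x ∈ D, BddBelow (Set.range fun a => v a x))
    {B : ℝ} {g : A → E → ℝ} (hg : ∀ a, IsWeakLaplacianOn D (v a) (g a))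
    (hB : ∀ a, ∀ᵐ x ∂(volume.restrict D), g a x ≤ B)
    (hu : MeasurableLocallyBoundedOn D fun x => ⨅ a, v a x)
    {x : E} {R : ℝ} (hR : 0 ≤ R) (hRD : closedBall x R ⊆ D) :
    radialMean (fun x => ⨅ a, v a x) R x ≤ (∫ z : E, radialKernel z) * (⨅ a, v a x) +
      B * (R ^ 2 / 2 * ∫ z : E, radialPotential z) := by
  -- Since c ≥ 0, the whole right-hand side is an infimum over a, so it suffices to bound the mean
  -- by the value for each a.
  rw [Real.mul_iInf_of_nonneg integral_radialKernel_nonneg, ← sub_le_iff_le_add]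
  refine le_ciInf fun a => ?_
  rw [sub_le_iff_le_add]
  refine le_trans ?_ (radialMean_le_of_isWeakLaplacianOn (hcont a) (hg a) (hB a) hR hRD)
  have hvc : ContinuousOn (v a) (closedBall x R) := (hcont a).mono hRD
  have hva : MeasurableLocallyBoundedOn (closedBall x R) (v a) := by
    refine ⟨?_, fun K hK hKc => hKc.exists_bound_of_continuousOn (hvc.mono hK)⟩
    classical
    rw [← Set.piecewise_eq_indicator]
    exact hvc.measurable_piecewise continuousOn_const measurableSet_closedBall
  refine integral_mono (hu.integrable_comp_mul_radialKernel hR hRD)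
    (hva.integrable_comp_mul_radialKernel hR subset_rfl) fun z => ?_
  rcases le_or_gt ‖z‖ 1 with hz | hz
  · exact mul_le_mul_of_nonneg_right
      (ciInf_le (hbdd _ (hRD (add_smul_mem_closedBall hR x hz))) a) (radialKernel_nonneg z)
  · simp [radialKernel_of_one_le hz.le]

end Duality

section PSH

/-! ### Plurisubharmonic functions -/

lemma UpperSemicontinuousOn.measurable_indicator {X : Type*} [TopologicalSpace X]
    [MeasurableSpace X] [OpensMeasurableSpace X] {D : Set X} (hD : MeasurableSet D) {u : X → ℝ}
    (hu : UpperSemicontinuousOn u D) : Measurable (D.indicator u) := by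
  refine measurable_of_restrict_of_restrict_compl hD ?_ ?_
  · convert! (upperSemicontinuousOn_iff_restrict.2 hu).measurable using 1
    ext x
    simp
  · convert! (measurable_const : Measurable fun _ : (Dᶜ : Set X) => (0 : ℝ)) using 1
    ext x
    exact Set.indicator_of_notMem x.2 u

variable {n : ℕ}

/-- Multiplication by a complex number of modulus one, as an isometry of `ℂⁿ`. -/
noncomputable def unitSmulIsometry (ζ : ℂ) (hζ : ‖ζ‖ = 1) :
    EuclideanSpace ℂ (Fin n) ≃ₗᵢ[ℝ] EuclideanSpace ℂ (Fin n) :=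
  LinearIsometry.toLinearIsometryEquiv
    { toFun := fun z => ζ • z
      map_add' := smul_add ζ
      map_smul' := fun r z => smul_comm ζ r z
      norm_map' := fun z => by simp [norm_smul, hζ] } rfl

/-- Multiplication by ζ is an isometry of the underlying real space, so it preserves both Lebesgue
measure and the radial kernel. -/
lemma radialMean_comp_smul (w : EuclideanSpace ℂ (Fin n) → ℝ) (r : ℝ)
    (x : EuclideanSpace ℂ (Fin n)) {ζ : ℂ} (hζ : ‖ζ‖ = 1) :
    ∫ z, w (x + ζ • r • z) * radialKernel z = radialMean w r x := by
  have h := (unitSmulIsometry (n := n) ζ hζ).measurePreserving.integral_comp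
    (unitSmulIsometry (n := n) ζ hζ).toHomeomorph.measurableEmbedding
    (fun z => w (x + r • z) * radialKernel z)
  rw [radialMean, ← h]
  congr 1 with z
  have e : unitSmulIsometry ζ hζ z = ζ • z := rfl
  rw [radialKernel_congr ((unitSmulIsometry ζ hζ).norm_map z), e, smul_comm ζ r z]

/-- Plurisubharmonic functions satisfy the mean value inequality on balls. -/
theorem IsPSHOn.le_radialMean {D : Set (EuclideanSpace ℂ (Fin n))}
    {u : EuclideanSpace ℂ (Fin n) → ℝ} (hpsh : IsPSHOn D u)
    (hu : MeasurableLocallyBoundedOn D u) {x : EuclideanSpace ℂ (Fin n)} {R : ℝ} (hR : 0 ≤ R)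
    (hRD : closedBall x R ⊆ D) :
    (∫ z : EuclideanSpace ℂ (Fin n), radialKernel z) * u x ≤ radialMean u R x := by
  obtain ⟨hwm, C, hC⟩ := hu.exists_measurable_bounded hRD (isCompact_closedBall x R)
  set w := (closedBall x R).indicator u with hw
  have hwu : Set.EqOn u w (closedBall x R) := fun y hy => (Set.indicator_of_mem hy u).symm
  rw [radialMean_congr hR hwu]
  have hmem : ∀ z : EuclideanSpace ℂ (Fin n), ‖z‖ ≤ 1 → ∀ ζ : ℂ, ‖ζ‖ ≤ 1 →
      x + ζ • R • z ∈ closedBall x R := by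
    intro z hz ζ hζ
    rw [smul_comm]
    refine add_smul_mem_closedBall hR x ?_
    rw [norm_smul]
    exact mul_le_one₀ hζ (norm_nonneg z) hz
  have hcircle : ∀ z : EuclideanSpace ℂ (Fin n), ‖z‖ ≤ 1 →
      u x ≤ (2 * Real.pi)⁻¹ * ∫ θ in Set.Ioc 0 (2 * Real.pi), w (x + circleMap 0 1 θ • R • z) := by
    intro z hz
    refine (hpsh.le_circleAverage x (R • z) fun ζ hζ => hRD (hmem z hz ζ hζ)).2.trans_eq ?_
    rw [Real.circleAverage_def, intervalIntegral.integral_of_le Real.two_pi_pos.le, smul_eq_mul]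
    congr 2 with θ
    exact hwu (hmem z hz _ (by simp))
  have hcm : Continuous (circleMap 0 1) := continuous_circleMap 0 1
  have hprod : Integrable (fun p : EuclideanSpace ℂ (Fin n) × ℝ =>
      w (x + circleMap 0 1 p.2 • R • p.1) * radialKernel p.1)
      (volume.prod (volume.restrict (Set.Ioc 0 (2 * Real.pi)))) := by
    have h1 : Integrable (fun p : EuclideanSpace ℂ (Fin n) × ℝ => radialKernel p.1 * (1 : ℝ))
        (volume.prod (volume.restrict (Set.Ioc 0 (2 * Real.pi)))) :=
      integrable_radialKernel.mul_prod (integrable_const 1)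
    simp only [mul_one] at h1
    have h2 : Continuous fun p : EuclideanSpace ℂ (Fin n) × ℝ =>
        x + circleMap 0 1 p.2 • R • p.1 :=
      continuous_const.add ((hcm.comp continuous_snd).smul (continuous_fst.const_smul R))
    have h3 : Measurable fun p : EuclideanSpace ℂ (Fin n) × ℝ =>
        w (x + circleMap 0 1 p.2 • R • p.1) := hwm.comp h2.measurable
    exact h1.bdd_mul (c := C) h3.aestronglyMeasurable (Eventually.of_forall fun p => hC _)
  have hI : Integrable (fun z : EuclideanSpace ℂ (Fin n) =>
      ∫ θ in Set.Ioc 0 (2 * Real.pi), w (x + circleMap 0 1 θ • R • z) * radialKernel z) :=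
    hprod.integral_prod_left
  -- After exchanging the integrals, rotation invariance makes the inner integral independent of θ.
  have h2 : ∫ z, ∫ θ in Set.Ioc 0 (2 * Real.pi), w (x + circleMap 0 1 θ • R • z) * radialKernel z
      = 2 * Real.pi * radialMean w R x := by
    rw [integral_integral_swap hprod]
    have : ∀ θ : ℝ, ∫ z, w (x + circleMap 0 1 θ • R • z) * radialKernel z = radialMean w R x :=
      fun θ => radialMean_comp_smul w R x (by simp)
    simp only [this]
    simp [Real.two_pi_pos.le]
  have h3 : (∫ z : EuclideanSpace ℂ (Fin n), radialKernel z) * u x ≤ ∫ z, (2 * Real.pi)⁻¹ *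
      ∫ θ in Set.Ioc 0 (2 * Real.pi), w (x + circleMap 0 1 θ • R • z) * radialKernel z := by
    rw [← integral_mul_const]
    refine integral_mono (integrable_radialKernel.mul_const _) (hI.const_mul _) fun z => ?_
    simp only [integral_mul_const]
    rcases le_or_gt ‖z‖ 1 with hz | hz
    · rw [← mul_assoc, mul_comm (radialKernel z)]
      exact mul_le_mul_of_nonneg_right (hcircle z hz) (radialKernel_nonneg z)
    · simp [radialKernel_of_one_le hz.le]
  rw [integral_const_mul, h2, inv_mul_cancel_left₀ Real.two_pi_pos.ne'] at h3
  exact h3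

end PSH

/-! ### Representing a bounded distributional Laplacian by a function -/

/-- A linear functional dominated by the norm of `ι v` in a Hilbert space is represented by a
vector of that space. -/
lemma exists_forall_eq_inner {V H : Type*} [AddCommGroup V] [Module ℝ V] [NormedAddCommGroup H]
    [InnerProductSpace ℝ H] [CompleteSpace H] (ι : V →ₗ[ℝ] H) (T : V →ₗ[ℝ] ℝ) (C : ℝ)
    (h : ∀ v, |T v| ≤ C * ‖ι v‖) : ∃ f : H, ∀ v, T v = inner ℝ f (ι v) := by
  -- The bound forces T to vanish on ker ι, so T factors through ι. The factor is bounded on the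
  -- range of ι, extends by Hahn–Banach, and is represented by Riesz.
  have hT : T ∈ LinearMap.range ι.dualMap := by
    rw [LinearMap.range_dualMap_eq_dualAnnihilator_ker, Submodule.mem_dualAnnihilator]
    intro v hv
    have := h v
    rw [LinearMap.mem_ker.1 hv, norm_zero, mul_zero] at this
    exact abs_nonpos_iff.1 this
  obtain ⟨S, hS⟩ := hT
  have hSv : ∀ v, S (ι v) = T v := fun v => congr($hS v)
  let S' : StrongDual ℝ (LinearMap.range ι) :=
    (S.domRestrict (LinearMap.range ι)).mkContinuous C (by
      rintro ⟨_, v, rfl⟩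
      simpa [hSv] using h v)
  obtain ⟨g, hg, -⟩ := exists_extension_norm_eq _ S'
  refine ⟨(InnerProductSpace.toDual ℝ H).symm g, fun v => ?_⟩
  rw [InnerProductSpace.toDual_symm_apply, ← hSv v]
  exact (hg ⟨ι v, v, rfl⟩).symm

section Represent

variable {E : Type*} [NormedAddCommGroup E] [InnerProductSpace ℝ E] [FiniteDimensional ℝ E]
  [MeasurableSpace E] [BorelSpace E]

/-- The space of smooth functions with compact support contained in `D`. -/
def testFunctions (D : Set E) : Submodule ℝ (E → ℝ) where
  carrier := {φ | ContDiff ℝ ∞ φ ∧ HasCompactSupport φ ∧ tsupport φ ⊆ D}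
  add_mem' := fun ha hb => ⟨ha.1.add hb.1, ha.2.1.add hb.2.1,
    (tsupport_add _ _).trans (Set.union_subset ha.2.2 hb.2.2)⟩
  zero_mem' := ⟨contDiff_const, HasCompactSupport.zero, by simp [tsupport]⟩
  smul_mem' := fun c f hf => ⟨contDiff_const.smul hf.1, hf.2.1.smul_left,
    (tsupport_smul_subset_right (fun _ => c) f).trans hf.2.2⟩

lemma integrable_mul_laplacian {D : Set E} {u φ : E → ℝ} (hu : LocallyIntegrableOn u D)
    (hφ : φ ∈ testFunctions D) : Integrable fun x => u x * Δ φ x :=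
  integrable_mul_of_locallyIntegrableOn hu (continuous_laplacian hφ.1)
    (hasCompactSupport_laplacian hφ.2.1) ((tsupport_laplacian_subset φ).trans hφ.2.2)

/-- The distributional Laplacian of `u` on `D`, as a linear functional on test functions. -/
noncomputable def weakLaplacian {D : Set E} {u : E → ℝ} (hu : LocallyIntegrableOn u D) :
    testFunctions D →ₗ[ℝ] ℝ where
  toFun φ := ∫ x in D, u x * Δ (φ : E → ℝ) x
  map_add' φ ψ := by
    rw [← integral_add (integrable_mul_laplacian hu φ.2).integrableOn
      (integrable_mul_laplacian hu ψ.2).integrableOn]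
    congr 1 with x
    rw [Submodule.coe_add, ContDiffAt.laplacian_add (contDiff_infty.1 φ.2.1 2).contDiffAt
      (contDiff_infty.1 ψ.2.1 2).contDiffAt, mul_add]
  map_smul' c φ := by
    rw [RingHom.id_apply, smul_eq_mul, ← integral_const_mul]
    congr 1 with x
    rw [Submodule.coe_smul, InnerProductSpace.laplacian_smul c
      (contDiff_infty.1 φ.2.1 2).contDiffAt, smul_eq_mul]
    ring

lemma exists_cutoff {D K : Set E} (hD : IsOpen D) (hK : IsCompact K) (hKD : K ⊆ D) :
    ∃ χ ∈ testFunctions D, (∀ x ∈ K, χ x = 1) ∧ ∀ x, χ x ∈ Set.Icc (0 : ℝ) 1 := by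
  obtain ⟨δ, hδ, hδD⟩ := hK.exists_cthickening_subset_open hD hKD
  obtain ⟨χ, h0, h1, h01⟩ := exists_contMDiffMap_zero_one_of_isClosed (n := ⊤)
    (modelWithCornersSelf ℝ E) (isOpen_thickening (δ := δ) (E := K)).isClosed_compl hK.isClosed
    (Set.disjoint_compl_left_iff_subset.2 (self_subset_thickening hδ K))
  have hsub : tsupport χ ⊆ cthickening δ K := by
    refine closure_minimal (fun x hx => ?_) isClosed_cthickening
    by_contra h
    exact hx (h0 fun h' => h (thickening_subset_cthickening δ K h'))
  exact ⟨χ, ⟨χ.contMDiff.contDiff, hK.cthickening.of_isClosed_subset (isClosed_tsupport _) hsub,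
    hsub.trans hδD⟩, h1, h01⟩

/-- Reason for the Gaussian weight: D may have infinite volume, and the weight that compensates
exp(|x|²) has finite mass. -/
lemma integrable_exp_neg_normSq : Integrable fun x : E => Real.exp (-‖x‖ ^ 2) := by
  have h := (GaussianFourier.integrable_cexp_neg_mul_sq_norm_add (V := E) (b := 1) (by simp) 0 0).norm
  refine h.congr (Eventually.of_forall fun x => ?_)
  simp only [Complex.norm_exp]
  congr 1
  simp [← Complex.ofReal_pow]

lemma contDiff_exp_normSq : ContDiff ℝ ∞ fun x : E => Real.exp (‖x‖ ^ 2) :=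
  Real.contDiff_exp.comp (contDiff_norm_sq ℝ)

lemma contDiff_exp_half_normSq : ContDiff ℝ ∞ fun x : E => Real.exp (‖x‖ ^ 2 / 2) :=
  Real.contDiff_exp.comp ((contDiff_norm_sq ℝ).div_const 2)

lemma contDiff_exp_neg_normSq : ContDiff ℝ ∞ fun x : E => Real.exp (-‖x‖ ^ 2) :=
  Real.contDiff_exp.comp (contDiff_norm_sq ℝ).neg

lemma memLp_mul_exp {D : Set E} {φ : E → ℝ} (hφ : φ ∈ testFunctions D) :
    MemLp (fun x => φ x * Real.exp (‖x‖ ^ 2 / 2)) 2 :=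
  (hφ.1.continuous.mul contDiff_exp_half_normSq.continuous).memLp_of_hasCompactSupport
    hφ.2.1.mul_right

/-- The embedding of test functions into `L²`, with the weight `exp (|x|² / 2)`. -/
noncomputable def testToL2 (D : Set E) : testFunctions D →ₗ[ℝ] Lp ℝ 2 (volume : Measure E) where
  toFun φ := (memLp_mul_exp φ.2).toLp _
  map_add' φ ψ := by
    rw [← MemLp.toLp_add]
    congr 1
    ext x
    simp [add_mul]
  map_smul' c φ := by
    rw [RingHom.id_apply, ← MemLp.toLp_const_smul]
    congr 1
    ext x
    simp [mul_assoc]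

lemma norm_testToL2_sq {D : Set E} (φ : testFunctions D) :
    ‖testToL2 D φ‖ ^ 2 = ∫ x, (φ : E → ℝ) x ^ 2 * Real.exp (‖x‖ ^ 2) := by
  rw [← real_inner_self_eq_norm_sq, L2.inner_def]
  refine integral_congr_ae ?_
  filter_upwards [(memLp_mul_exp φ.2).coeFn_toLp] with x hx
  have : (testToL2 D φ : E → ℝ) x = (φ : E → ℝ) x * Real.exp (‖x‖ ^ 2 / 2) := hx
  rw [this]
  have e : Real.exp (‖x‖ ^ 2) = Real.exp (‖x‖ ^ 2 / 2) * Real.exp (‖x‖ ^ 2 / 2) := by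
    rw [← Real.exp_add]; ring_nf
  rw [e, real_inner_self_eq_norm_sq, Real.norm_eq_abs, sq_abs]
  ring

/-! ### Positive functionals dominated by Lebesgue measure have bounded densities -/

section Bound

variable {D : Set E} {T : testFunctions D →ₗ[ℝ] ℝ} {B : ℝ}

/-- By the inequality of arithmetic and geometric means, |φ| ≤ (t/2) φ² exp(|x|²) + (2t)⁻¹
exp(-|x|²). Multiplied by a cutoff equal to 1 on the support of φ, the right side becomes a test
function ψ ≥ |φ|; positivity gives |T φ| ≤ T ψ, and the upper bound on T finishes. Using a smooth
majorant avoids |φ|, which need not be smooth. -/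
lemma abs_le_of_nonneg_of_le (hD : IsOpen D) (hB : 0 ≤ B)
    (hT0 : ∀ φ : testFunctions D, (∀ x, 0 ≤ (φ : E → ℝ) x) → 0 ≤ T φ)
    (hTB : ∀ φ : testFunctions D, (∀ x, 0 ≤ (φ : E → ℝ) x) → T φ ≤ B * ∫ x, (φ : E → ℝ) x)
    (φ : testFunctions D) {t : ℝ} (ht : 0 < t) :
    |T φ| ≤ B * (t / 2 * ‖testToL2 D φ‖ ^ 2 + (2 * t)⁻¹ * ∫ x : E, Real.exp (-‖x‖ ^ 2)) := by
  obtain ⟨χ, hχ, hχ1, hχ01⟩ := exists_cutoff hD φ.2.2.1 φ.2.2.2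
  set ρ : E → ℝ := fun x => t / 2 * ((φ : E → ℝ) x ^ 2 * Real.exp (‖x‖ ^ 2)) +
    (2 * t)⁻¹ * Real.exp (-‖x‖ ^ 2) with hρ
  have hρc : ContDiff ℝ ∞ ρ :=
    (contDiff_const.mul ((φ.2.1.pow 2).mul contDiff_exp_normSq)).add
      (contDiff_const.mul contDiff_exp_neg_normSq)
  have hρ0 : ∀ x, 0 ≤ ρ x := fun x => by positivity
  let ψ : testFunctions D := ⟨fun x => χ x * ρ x, hχ.1.mul hρc, hχ.2.1.mul_right,
    (tsupport_mul_subset_left (f := χ) (g := ρ)).trans hχ.2.2⟩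
  have hψ : ∀ x, (ψ : E → ℝ) x = χ x * ρ x := fun x => rfl
  have hψ0 : ∀ x, 0 ≤ (ψ : E → ℝ) x := fun x => mul_nonneg (hχ01 x).1 (hρ0 x)
  have hle : ∀ x, |(φ : E → ℝ) x| ≤ (ψ : E → ℝ) x := by
    intro x
    by_cases hx : x ∈ tsupport (φ : E → ℝ)
    · rw [hψ, hχ1 x hx, one_mul]
      simp only [hρ]
      rw [Real.exp_neg]
      set s := Real.exp (‖x‖ ^ 2)
      have hs : 0 < s := Real.exp_pos _
      set a := (φ : E → ℝ) x
      have e : t / 2 * (a ^ 2 * s) + (2 * t)⁻¹ * s⁻¹ - |a| = (t * s * |a| - 1) ^ 2 / (2 * t * s) := by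
        rw [← sq_abs a]
        field_simp
        ring
      have : 0 ≤ (t * s * |a| - 1) ^ 2 / (2 * t * s) := by positivity
      linarith
    · rw [image_eq_zero_of_notMem_tsupport hx, abs_zero]
      exact hψ0 x
  have h1 : |T φ| ≤ T ψ := by
    have hp := hT0 (ψ + φ) fun x => by
      have := neg_le_of_abs_le (hle x)
      rw [Submodule.coe_add, Pi.add_apply]
      linarith
    have hm := hT0 (ψ - φ) fun x => by
      have := le_of_abs_le (hle x)
      rw [Submodule.coe_sub, Pi.sub_apply]
      linarith
    rw [map_add] at hp
    rw [map_sub] at hm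
    rw [abs_le]
    constructor <;> linarith
  refine h1.trans ((hTB ψ hψ0).trans (mul_le_mul_of_nonneg_left ?_ hB))
  have hi1 : Integrable fun x => (φ : E → ℝ) x ^ 2 * Real.exp (‖x‖ ^ 2) := by
    have hc : HasCompactSupport fun x => (φ : E → ℝ) x ^ 2 :=
      φ.2.2.1.comp_left (g := fun y : ℝ => y ^ 2) (by simp)
    exact ((φ.2.1.continuous.pow 2).mul
      contDiff_exp_normSq.continuous).integrable_of_hasCompactSupport hc.mul_right
  rw [norm_testToL2_sq, ← integral_const_mul, ← integral_const_mul,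
    ← integral_add (hi1.const_mul _) (integrable_exp_neg_normSq.const_mul _)]
  refine integral_mono (ψ.2.1.continuous.integrable_of_hasCompactSupport ψ.2.2.1)
    ((hi1.const_mul _).add (integrable_exp_neg_normSq.const_mul _)) fun x => ?_
  rw [hψ]
  exact mul_le_of_le_one_left (hρ0 x) (hχ01 x).2

lemma exists_abs_le_mul_norm (hD : IsOpen D) (hB : 0 ≤ B)
    (hT0 : ∀ φ : testFunctions D, (∀ x, 0 ≤ (φ : E → ℝ) x) → 0 ≤ T φ)
    (hTB : ∀ φ : testFunctions D, (∀ x, 0 ≤ (φ : E → ℝ) x) → T φ ≤ B * ∫ x, (φ : E → ℝ) x) :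
    ∃ C, ∀ φ, |T φ| ≤ C * ‖testToL2 D φ‖ := by
  set P := ∫ x : E, Real.exp (-‖x‖ ^ 2)
  have hP : 0 ≤ P := integral_nonneg fun x => (Real.exp_pos _).le
  refine ⟨B * (1 + P) / 2, fun φ => ?_⟩
  have h := fun t ht => abs_le_of_nonneg_of_le hD hB hT0 hTB φ (t := t) ht
  rcases (norm_nonneg (testToL2 D φ)).eq_or_lt with h0 | h0
  · rw [← h0, mul_zero]
    refine le_of_forall_pos_le_add fun ε hε => ?_
    -- When the norm vanishes only the (2t)⁻¹ term survives, and a large t makes it at most ε; the +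
    -- 1 keeps t positive when B P = 0.
    have h2 := h ((B * P + 1) / ε) (by positivity)
    rw [← h0] at h2
    refine h2.trans ?_
    have : B * ((B * P + 1) / ε / 2 * 0 ^ 2 + (2 * ((B * P + 1) / ε))⁻¹ * P) =
        ε * (B * P / (2 * (B * P + 1))) := by
      field_simp
      simp
      ring
    rw [this, zero_add]
    refine mul_le_of_le_one_right hε.le ?_
    rw [div_le_one (by positivity)]
    nlinarith [mul_nonneg hB hP]
  -- With t = 1/‖φ‖ both terms become linear in the norm, giving the constant B (1 + P)/2.
  · refine (h ‖testToL2 D φ‖⁻¹ (by positivity)).trans_eq ?_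
    field_simp
    rfl

/-- A positive functional on test functions which is at most `B` times the integral is given by
a function with values in `[0, B]`. -/
theorem exists_locallyIntegrable_of_nonneg_of_le (hD : IsOpen D) (hB : 0 ≤ B)
    (hT0 : ∀ φ : testFunctions D, (∀ x, 0 ≤ (φ : E → ℝ) x) → 0 ≤ T φ)
    (hTB : ∀ φ : testFunctions D, (∀ x, 0 ≤ (φ : E → ℝ) x) → T φ ≤ B * ∫ x, (φ : E → ℝ) x) :
    ∃ g : E → ℝ, LocallyIntegrable g ∧ (∀ φ : testFunctions D, T φ = ∫ x, g x * (φ : E → ℝ) x) ∧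
      ∀ᵐ x ∂(volume.restrict D), 0 ≤ g x ∧ g x ≤ B := by
  obtain ⟨C, hC⟩ := exists_abs_le_mul_norm hD hB hT0 hTB
  obtain ⟨f, hf⟩ := exists_forall_eq_inner _ _ C hC
  have hg : LocallyIntegrable fun x => f x * Real.exp (‖x‖ ^ 2 / 2) :=
    ((Lp.memLp f).locallyIntegrable one_le_two).mul_continuous contDiff_exp_half_normSq.continuous
  have hTg : ∀ φ : testFunctions D,
      T φ = ∫ x, f x * Real.exp (‖x‖ ^ 2 / 2) * (φ : E → ℝ) x := by
    intro φ
    rw [hf, L2.inner_def]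
    refine integral_congr_ae ?_
    filter_upwards [(memLp_mul_exp φ.2).coeFn_toLp] with x hx
    have : (testToL2 D φ : E → ℝ) x = (φ : E → ℝ) x * Real.exp (‖x‖ ^ 2 / 2) := hx
    rw [this]
    simp
    ring
  refine ⟨_, hg, hTg, ?_⟩
  rw [ae_restrict_iff' hD.measurableSet]
  -- Outer radius twice the inner one: the bounded ratio is what the differentiation theorem for
  -- shrinking bumps requires (K = 2).
  let b : ℕ → ContDiffBump (0 : E) := fun i =>
    ⟨1 / ((i : ℝ) + 1), 2 * (1 / ((i : ℝ) + 1)), by positivity, by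
      have : 0 < 1 / ((i : ℝ) + 1) := by positivity
      linarith⟩
  have hb : Tendsto (fun i => (b i).rOut) atTop (𝓝 0) := by
    simpa [b] using tendsto_one_div_add_atTop_nhds_zero_nat.const_mul (2 : ℝ)
  filter_upwards [ContDiffBump.ae_convolution_tendsto_right_of_locallyIntegrable (K := 2) hb
    (Eventually.of_forall fun i => le_rfl) hg] with x hx hxD
  obtain ⟨δ, hδ, hδD⟩ := nhds_basis_closedBall.mem_iff.1 (hD.mem_nhds hxD)
  have hev : ∀ᶠ i in atTop, ((b i).normed volume ⋆[ContinuousLinearMap.lsmul ℝ ℝ, volume]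
      fun x => f x * Real.exp (‖x‖ ^ 2 / 2)) x ∈ Set.Icc 0 B := by
    filter_upwards [hb.eventually_lt_const hδ] with i hi
    have hsupp : tsupport (fun y => (b i).normed volume (x - y)) ⊆ closedBall x δ := by
      refine closure_minimal (fun y hy => ?_) isClosed_closedBall
      have : x - y ∈ Function.support ((b i).normed volume) := hy
      rw [ContDiffBump.support_normed_eq, mem_ball_zero_iff] at this
      rw [mem_closedBall, dist_comm, dist_eq_norm]
      linarith
    let φ : testFunctions D := ⟨fun y => (b i).normed volume (x - y),
      (b i).contDiff_normed.comp (contDiff_const.sub contDiff_id),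
      (isCompact_closedBall x δ).of_isClosed_subset (isClosed_tsupport _) hsupp, hsupp.trans hδD⟩
    have hφ0 : ∀ y, 0 ≤ (φ : E → ℝ) y := fun y => (b i).nonneg_normed _
    have hφ1 : ∫ y, (φ : E → ℝ) y = 1 :=
      (integral_sub_left_eq_self (fun y => (b i).normed volume y) volume x).trans
        (b i).integral_normed
    -- The convolution at x is T applied to a nonnegative test function of integral 1, hence lies in
    -- [0, B], and so does its limit.
    have e : ((b i).normed volume ⋆[ContinuousLinearMap.lsmul ℝ ℝ, volume]
        fun x => f x * Real.exp (‖x‖ ^ 2 / 2)) x = T φ := by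
      rw [hTg, convolution_eq_swap]
      congr 1 with y
      simp only [ContinuousLinearMap.lsmul_apply, smul_eq_mul, φ]
      ring
    rw [e]
    refine ⟨hT0 φ hφ0, ?_⟩
    simpa [hφ1] using hTB φ hφ0
  exact isClosed_Icc.mem_of_tendsto hx hev

end Bound

end Represent

/-! ### Assembly of the theorem -/

lemma UniformlyLocallyBoundedOn.bddBelow {A X : Type*} [TopologicalSpace X] {D : Set X}
    {v : A → X → ℝ} (h : UniformlyLocallyBoundedOn D v) {x : X} (hx : x ∈ D) :
    BddBelow (Set.range fun a => v a x) := by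
  obtain ⟨C, hC⟩ := h {x} (by simpa using hx) isCompact_singleton
  refine ⟨-C, ?_⟩
  rintro _ ⟨a, rfl⟩
  exact neg_le_of_abs_le (hC a x rfl)

lemma UniformlyLocallyBoundedOn.measurableLocallyBoundedOn_iInf {E : Type*} [NormedAddCommGroup E]
    [MeasurableSpace E] {A : Type*} [Nonempty A] {D : Set E} {v : A → E → ℝ}
    (h : UniformlyLocallyBoundedOn D v) (hm : Measurable (D.indicator fun x => ⨅ a, v a x)) :
    MeasurableLocallyBoundedOn D fun x => ⨅ a, v a x where
  measurable_indicator := hm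
  exists_bound K hK hKc := by
    obtain ⟨C, hC⟩ := h K hK hKc
    refine ⟨C, fun x hx => abs_le.2 ⟨le_ciInf fun a => neg_le_of_abs_le (hC a x hx), ?_⟩⟩
    let a : A := Classical.arbitrary A
    exact (ciInf_le (h.bddBelow (hK hx)) a).trans (le_of_abs_le (hC a x hx))

/-- A nonempty open set has positive measure, so the almost everywhere bound holds at some point. -/
lemma AbsLaplacianLEOn.nonneg {E : Type*} [NormedAddCommGroup E] [InnerProductSpace ℝ E]
    [FiniteDimensional ℝ E] [MeasurableSpace E] [BorelSpace E] {D : Set E} (hD : IsOpen D)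
    (hDn : D.Nonempty) {u : E → ℝ} {B : ℝ} (h : AbsLaplacianLEOn D u B) : 0 ≤ B := by
  obtain ⟨g, -, hg⟩ := h
  have : (ae (volume.restrict D)).NeBot := by
    rw [ae_neBot, Ne, Measure.restrict_eq_zero]
    exact (hD.measure_pos volume hDn).ne'
  obtain ⟨x, hx⟩ := hg.exists
  exact (abs_nonneg _).trans hx

theorem proposition4p3 {n : ℕ} (D : Set (EuclideanSpace ℂ (Fin n))) (hD : IsOpen D)
    (hDc : IsConnected D) {A : Type*} [Nonempty A]
    (v : A → EuclideanSpace ℂ (Fin n) → ℝ) (hcont : ∀ a, ContinuousOn (v a) D)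
    (hbdd : UniformlyLocallyBoundedOn D v)
    (B : ℝ) (hB : ∀ a, AbsLaplacianLEOn D (v a) B)
    (hpsh : IsPSHOn D (fun z => ⨅ a, v a z)) :
    AbsLaplacianLEOn D (fun z => ⨅ a, v a z) B := by
  have hB0 : 0 ≤ B := (hB (Classical.arbitrary A)).nonneg hD hDc.nonempty
  have hu : MeasurableLocallyBoundedOn D fun z => ⨅ a, v a z :=
    hbdd.measurableLocallyBoundedOn_iInf
      (hpsh.upperSemicontinuousOn.measurable_indicator hD.measurableSet)
  have hloc := hu.locallyIntegrableOn hD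
  choose g hg hgB using hB
  obtain ⟨G, hG, hTG, hGB⟩ := exists_locallyIntegrable_of_nonneg_of_le (T := weakLaplacian hloc)
    hD hB0
    (fun φ hφ => by
      -- Positivity of the Laplacian is the upper bound 0 for the negated infimum, whose mean value
      -- inequality comes from plurisubharmonicity.
      have h := integral_mul_laplacian_le_of_radialMean_le hD hu.neg (B := 0)
        (fun x R hR hRD => by
          rw [radialMean_neg, zero_mul, add_zero, mul_neg, neg_le_neg_iff]
          exact hpsh.le_radialMean hu hR hRD)
        φ.2.1 φ.2.2.1 φ.2.2.2 hφ
      simp only [neg_mul, integral_neg, zero_mul, neg_nonpos] at h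
      exact h)
    (fun φ hφ => integral_mul_laplacian_le_of_radialMean_le hD hu
      (fun x R hR hRD => radialMean_iInf_le hcont (fun x hx => hbdd.bddBelow hx) hg
        (fun a => (hgB a).mono fun x hx => le_of_abs_le hx) hu hR hRD)
      φ.2.1 φ.2.2.1 φ.2.2.2 hφ)
  refine ⟨G, ⟨hloc, hG.locallyIntegrableOn D, fun φ hφ hφc hφD => ?_⟩, ?_⟩
  · rw [setIntegral_mul_eq_integral_of_tsupport_subset hφD]
    exact hTG ⟨φ, hφ, hφc, hφD⟩
  · filter_upwards [hGB] with x hx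
    rw [abs_of_nonneg hx.1]
    exact hx.2
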